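/- Let $\Theta\subset\mathbb{R}$ be non-empty and let $\{F_\theta:\theta\in\Theta\}$ be a family of distribution functions on $\mathbb{R}$ such that, for each $\theta\in\Theta$, there are $-\infty\le\alpha_\theta<\omega_\theta\le\infty$ for which the law with distribution function $F_\theta$ is concentrated on the open interval $(\alpha_\theta,\omega_\theta)$ and $F_\theta$ is continuous and strictly increasing on $(\alpha_\theta,\omega_\theta)$. Assume that each mean $\mu(\theta):=\int_{\alpha_\theta}^{\omega_\theta}x\,dF_\theta(x)$ exists and is finite and that, with $\mathcal{M}:=\bigcup_{\theta\in\Theta}(\alpha_\theta,\omega_\theta)$, for every $m\in\mathcal{M}$ the equation $\mu(\theta)=m$ has a unique solution $\theta\in\Theta$, denoted by $\mu^{-1}(m)$. For $\theta\in\Theta$ put $$\Lambda_\theta^*(x):=\sup_{\gamma\in\mathbb{R}}\{\gamma x-\Lambda_\theta(\gamma)\},\qquad \Lambda_\theta(\gamma):=\log\int_{\alpha_\theta}^{\omega_\theta}e^{\gamma x}\,dF_\theta(x)\in(-\infty,\infty].$$ Fix $\theta_0\in\Theta$, let $\{X_n:n\ge1\}$ be i.i.d. real random variables with distribution function $F_{\theta_0}$,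 let $\bar X_n:=\frac{X_1+\cdots+X_n}{n}$, and set $$J_{\theta_0}(\theta):=\begin{cases}\Lambda_{\theta_0}^*(\mu(\theta)) & \text{if }\theta\in\Theta\text{ and }\mu(\theta)\in(\alpha_{\theta_0},\omega_{\theta_0}),\\ \infty&\text{otherwise.}\end{cases}$$ Random variables $\{W_n:n\ge1\}$ with values in a topological space $\mathcal{W}$ satisfy the large deviation principle (LDP) with rate function $I:\mathcal{W}\to[0,\infty]$ if $I$ is lower semicontinuous, $\liminf_{n\to\infty}\frac1n\log P(W_n\in O)\ge-\inf_{w\in O}I(w)$ for all open $O\subset\mathcal{W}$, and $\limsup_{n\to\infty}\frac1n\log P(W_n\in C)\le-\inf_{w\in C}I(w)$ for all closed $C\subset\mathcal{W}$; a rate function $I$ is good if the sets $\{w\in\mathcal{W}:I(w)\le\eta\}$, $0\le\eta<\infty$, are compact. The following hold both with $\mathcal{W}=\Theta$ (with the subspace topology) and with $\mathcal{W}=\mathbb{R}$. (i) If there are $c_1,c_0\in\mathbb{R}$ with $c_1\ne0$ such that $\mu^{-1}(m)=c_1m+c_0$ for all $m\in\mathcal{M}$, then $\{\mu^{-1}(\bar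 X_n):n\ge1\}$ satisfies the LDP with rate function $J_{\theta_0}$. (ii) If the restriction of $\mu^{-1}$ to $(\alpha_{\theta_0},\omega_{\theta_0})$ is continuous and $\Lambda_{\theta_0}^*$ is a good rate function on $\mathbb{R}$, then $\{\mu^{-1}(\bar X_n):n\ge1\}$ satisfies the LDP with rate function $J_{\theta_0}$, and $J_{\theta_0}$ is a good rate function. -/

import Mathlib

open MeasureTheory ProbabilityTheory Filter Topology
open scoped ENNReal

noncomputable section

namespace MMEst

/-! ### Large deviation principles -/

/-- A rate function `I : 𝒲 → [0, ∞]`: nonnegative (as an extended real) and lower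
semicontinuous. -/
structure IsRateFunction {𝒲 : Type*} [TopologicalSpace 𝒲] (I : 𝒲 → EReal) : Prop where
  nonneg : ∀ w, 0 ≤ I w
  lowerSemicontinuous : LowerSemicontinuous I

/-- A rate function is good if all its level sets `{I ≤ η}`, `0 ≤ η < ∞`, are compact. -/
structure IsGoodRateFunction {𝒲 : Type*} [TopologicalSpace 𝒲] (I : 𝒲 → EReal) : Prop
    extends IsRateFunction I where
  isCompact_le : ∀ η : ℝ, 0 ≤ η → IsCompact {w | I w ≤ (η : EReal)}

/-- The random variables `W 1, W 2, …` (the value of `W` at `0` plays no role) satisfy the large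
deviation principle on the topological space `𝒲` with rate function `I`. Logarithms are taken in
the extended reals, with `log 0 = -∞`, and the infimum over the empty set is `+∞`. -/
structure SatisfiesLDP {Ω : Type*} [MeasurableSpace Ω] (P : Measure Ω)
    {𝒲 : Type*} [TopologicalSpace 𝒲] [MeasurableSpace 𝒲] (W : ℕ → Ω → 𝒲) (I : 𝒲 → EReal) :
    Prop where
  aemeasurable : ∀ n, 1 ≤ n → AEMeasurable (W n) P
  isRateFunction : IsRateFunction I
  lower_bound : ∀ O : Set 𝒲, IsOpen O →
    -(⨅ w ∈ O, I w) ≤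
      liminf (fun n : ℕ => ENNReal.log (P {ω | W n ω ∈ O}) / (n : EReal)) atTop
  upper_bound : ∀ C : Set 𝒲, IsClosed C →
    limsup (fun n : ℕ => ENNReal.log (P {ω | W n ω ∈ C}) / (n : EReal)) atTop ≤
      -(⨅ w ∈ C, I w)

/-! ### The statistical model -/

/-- The real points of the open interval with (possibly infinite) endpoints `a` and `b`. -/
def openInterval (a b : EReal) : Set ℝ := {x : ℝ | a < (x : EReal) ∧ (x : EReal) < b}

variable {Θ : Set ℝ}

/-- The mean `μ(θ)` of the law `F θ`. -/
def mean (F : Θ → Measure ℝ) (θ : Θ) : ℝ := ∫ x, x ∂(F θ)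

/-- The union over `θ ∈ Θ` of the intervals `(α θ, ω θ)`. -/
def meanSpace (α ω : Θ → EReal) : Set ℝ := ⋃ θ, openInterval (α θ) (ω θ)

/-- The family of laws `F θ`, `θ ∈ Θ ⊆ ℝ` (each given by a probability measure on `ℝ`), admits
moment-matching estimators: each `F θ` lives on an interval `(α θ, ω θ)`, on which its distribution
function is continuous and strictly increasing, it has a finite mean `μ(θ)`, and for every point `m`
of the union of the intervals the equation `μ(θ) = m` has a unique solution `θ ∈ Θ`. -/
structure MMCondition (F : Θ → Measure ℝ) (α ω : Θ → EReal) : Prop where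
  isProbabilityMeasure : ∀ θ, IsProbabilityMeasure (F θ)
  lt : ∀ θ, α θ < ω θ
  concentrated : ∀ θ, F θ (openInterval (α θ) (ω θ)) = 1
  continuousOn_cdf : ∀ θ, ContinuousOn (cdf (F θ)) (openInterval (α θ) (ω θ))
  strictMonoOn_cdf : ∀ θ, StrictMonoOn (cdf (F θ)) (openInterval (α θ) (ω θ))
  integrable : ∀ θ, Integrable (fun x : ℝ => x) (F θ)
  existsUnique_mean_eq : ∀ m ∈ meanSpace α ω, ∃! θ : Θ, mean F θ = m

/-- The inverse `μ⁻¹` of the mean function. Under `MMCondition`, `meanInv F m` is the unique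
`θ ∈ Θ` with `μ(θ) = m` for each `m` in `meanSpace α ω`; its values elsewhere are irrelevant, as the
sample means almost surely lie in `meanSpace α ω`. -/
def meanInv [Nonempty Θ] (F : Θ → Measure ℝ) : ℝ → Θ := Function.invFun (mean F)

/-- The logarithmic moment generating function `Λ(γ) = log ∫ exp (γ x) ν(dx)`, possibly `+∞`. -/
def logMGF (ν : Measure ℝ) (γ : ℝ) : EReal :=
  ENNReal.log (∫⁻ x, ENNReal.ofReal (Real.exp (γ * x)) ∂ν)

/-- The Legendre transform `Λ*(x) = sup_γ (γ x - Λ(γ))`. -/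
def logMGFStar (ν : Measure ℝ) (x : ℝ) : EReal :=
  ⨆ γ : ℝ, (((γ * x : ℝ) : EReal) - logMGF ν γ)

/-- The sample mean `(X₁ + ⋯ + Xₙ) / n`; the sample is indexed from `0`. -/
def sampleMean {Ω : Type*} (X : ℕ → Ω → ℝ) (n : ℕ) (ω : Ω) : ℝ :=
  (∑ i ∈ Finset.range n, X i ω) / (n : ℝ)

/-- The moment-matching estimator `μ⁻¹(X̄ₙ)`. -/
def mmEstimator [Nonempty Θ] {Ω : Type*} (F : Θ → Measure ℝ) (X : ℕ → Ω → ℝ) (n : ℕ) (ω : Ω) : Θ :=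
  meanInv F (sampleMean X n ω)

open Classical in
/-- The function `J_{θ₀}` on `Θ`: `Λ*_{θ₀}(μ(θ))` if `μ(θ) ∈ (α θ₀, ω θ₀)`, and `∞` otherwise. -/
def mmRate (F : Θ → Measure ℝ) (α ω : Θ → EReal) (θ₀ θ : Θ) : EReal :=
  if mean F θ ∈ openInterval (α θ₀) (ω θ₀) then logMGFStar (F θ₀) (mean F θ) else ⊤

open Classical in
/-- The function `J_{θ₀}` on the whole real line, equal to `∞` outside `Θ`. -/
def mmRateReal (F : Θ → Measure ℝ) (α ω : Θ → EReal) (θ₀ : Θ) (t : ℝ) : EReal :=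
  if h : t ∈ Θ then mmRate F α ω θ₀ ⟨t, h⟩ else ⊤

end MMEst

end

open MMEst

/-! The estimator is the image of the sample mean under μ⁻¹, so the theorem is Cramér's theorem
followed by a contraction. The map is continuous only on the interval carrying the law, but Λ* is
infinite off that interval (`logMGFStar_eq_top_of_notMem`), so nothing is lost there.

Cramér's theorem is obtained from a finite mean alone. Upper bound (`expGrowthSup_sampleMean_le`):
Chernoff's inequality at the points of the closed set nearest to the mean on either side. Lower
bound (`neg_logMGFStar_le_expGrowthInf`): truncate the law, tilt it exponentially so that its mean
becomes the target point, apply the weak law, and remove the truncation by compactness in the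
tilting parameter.

The contraction (`satisfiesLDP_comp_sampleMean`) takes lower semicontinuity of J as an input. In
(i), J on ℝ is Λ* composed with an affine map; in (ii), its level sets are continuous images of
compact ones (`isGoodRateFunction_of_image`). -/

noncomputable section

namespace MMEst

/-! ### Exponential moments and the Legendre transform -/

/-- The exponential moment `∫ exp (γ (y - x)) ν(dy)`, possibly infinite. -/
def expMoment (ν : Measure ℝ) (γ x : ℝ) : ℝ≥0∞ :=
  ∫⁻ y, ENNReal.ofReal (Real.exp (γ * (y - x))) ∂ν

/-- Centring the integrand at x turns each term of the Legendre transform into one logarithm, so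
later estimates avoid differences of extended reals. -/
lemma coe_sub_logMGF (ν : Measure ℝ) (γ x : ℝ) :
    ((γ * x : ℝ) : EReal) - logMGF ν γ = -ENNReal.log (expMoment ν γ x) := by
  have h : expMoment ν γ x = ENNReal.ofReal (Real.exp (-(γ * x))) *
      ∫⁻ y, ENNReal.ofReal (Real.exp (γ * y)) ∂ν := by
    rw [expMoment, ← lintegral_const_mul _ (by fun_prop)]
    refine lintegral_congr fun y => ?_
    rw [← ENNReal.ofReal_mul (Real.exp_pos _).le, ← Real.exp_add]
    congr 2
    ring
  rw [h, ENNReal.log_mul_add, ENNReal.log_ofReal_of_pos (Real.exp_pos _), Real.log_exp,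
    EReal.neg_add (Or.inl (EReal.coe_ne_bot _)) (Or.inl (EReal.coe_ne_top _)), logMGF,
    ← EReal.coe_neg, neg_neg]

lemma logMGFStar_eq_iSup (ν : Measure ℝ) (x : ℝ) :
    logMGFStar ν x = ⨆ γ : ℝ, -ENNReal.log (expMoment ν γ x) :=
  iSup_congr fun γ => coe_sub_logMGF ν γ x

lemma neg_log_expMoment_le (ν : Measure ℝ) (γ x : ℝ) :
    -ENNReal.log (expMoment ν γ x) ≤ logMGFStar ν x := by
  rw [logMGFStar_eq_iSup]
  exact le_iSup (fun γ : ℝ => -ENNReal.log (expMoment ν γ x)) γ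

lemma le_neg_logMGFStar {ν : Measure ℝ} {x : ℝ} {a : EReal}
    (h : ∀ γ : ℝ, a ≤ ENNReal.log (expMoment ν γ x)) : a ≤ -logMGFStar ν x := by
  rw [EReal.le_neg, logMGFStar_eq_iSup]
  exact iSup_le fun γ => EReal.neg_le_neg_iff.2 (h γ)

/-- The term γ = 0 vanishes. Each term is affine in x or constantly ±∞, and a supremum of continuous
functions is lower semicontinuous. -/
lemma isRateFunction_logMGFStar (ν : Measure ℝ) [IsProbabilityMeasure ν] :
    IsRateFunction (logMGFStar ν) where
  nonneg x := by
    refine le_trans ?_ (neg_log_expMoment_le ν 0 x)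
    simp [expMoment]
  lowerSemicontinuous := by
    refine lowerSemicontinuous_iSup fun γ => Continuous.lowerSemicontinuous ?_
    induction logMGF ν γ with
    | bot => simpa only [EReal.coe_sub_bot] using continuous_const
    | top => simpa only [EReal.sub_top] using continuous_const
    | coe a =>
      have : Continuous fun x : ℝ => ((γ * x - a : ℝ) : EReal) :=
        continuous_coe_real_ereal.comp (by fun_prop)
      simpa only [EReal.coe_sub] using this

/-- Tangent-line bound at `γ = 0`. -/
lemma one_le_expMoment (ν : Measure ℝ) [IsProbabilityMeasure ν]
    (hν : Integrable (fun y : ℝ => y) ν) {γ x : ℝ} (h : 0 ≤ γ * ((∫ y, y ∂ν) - x)) :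
    1 ≤ expMoment ν γ x := by
  by_cases hfin : expMoment ν γ x = ∞
  · simp [hfin]
  have hint : Integrable (fun y : ℝ => Real.exp (γ * (y - x))) ν :=
    (lintegral_ofReal_ne_top_iff_integrable (by fun_prop)
      (ae_of_all _ fun y => (Real.exp_pos _).le)).1 hfin
  have hlin : Integrable (fun y : ℝ => γ * (y - x)) ν :=
    (hν.sub (integrable_const x)).const_mul γ
  rw [expMoment, ← ofReal_integral_eq_lintegral_ofReal hint
    (ae_of_all _ fun y => (Real.exp_pos _).le), ← ENNReal.ofReal_one]
  refine ENNReal.ofReal_le_ofReal ?_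
  calc (1 : ℝ) ≤ γ * ((∫ y, y ∂ν) - x) + 1 := by linarith
    _ = ∫ y, (γ * (y - x) + 1) ∂ν := by
      rw [integral_add hlin (integrable_const 1), integral_const_mul,
        integral_sub hν (integrable_const x)]
      simp
    _ ≤ ∫ y, Real.exp (γ * (y - x)) ∂ν :=
      integral_mono (hlin.add (integrable_const 1)) hint fun y => Real.add_one_le_exp _

lemma logMGFStar_mean_le_zero (ν : Measure ℝ) [IsProbabilityMeasure ν]
    (hν : Integrable (fun y : ℝ => y) ν) : logMGFStar ν (∫ y, y ∂ν) ≤ 0 := by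
  rw [logMGFStar_eq_iSup]
  refine iSup_le fun γ => ?_
  have := one_le_expMoment ν hν (γ := γ) (x := ∫ y, y ∂ν) (by simp)
  rw [EReal.neg_le, neg_zero]
  simpa using this

lemma logMGFStar_eq_top_of_tendsto {ν : Measure ℝ} {x : ℝ} {u : ℕ → ℝ}
    (h : Tendsto (fun n => expMoment ν (u n) x) atTop (𝓝 0)) : logMGFStar ν x = ⊤ := by
  have hle : ∀ n, EReal.exp (-logMGFStar ν x) ≤ expMoment ν (u n) x := fun n => by
    rw [← ENNReal.log_le_log_iff, EReal.log_exp, EReal.neg_le]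
    exact neg_log_expMoment_le ν (u n) x
  simpa using ge_of_tendsto' h hle

/-- Almost all the mass lies strictly on one side of x, so the integrands are at most 1 and tend to
0: dominated convergence. -/
lemma tendsto_expMoment_zero {ν : Measure ℝ} [IsFiniteMeasure ν] {x ε : ℝ}
    (h : ∀ᵐ y ∂ν, ε * (y - x) < 0) :
    Tendsto (fun n : ℕ => expMoment ν (n * ε) x) atTop (𝓝 0) := by
  have h0 : (0 : ℝ≥0∞) = ∫⁻ _, 0 ∂ν := by simp
  rw [h0]
  refine tendsto_lintegral_of_dominated_convergence (fun _ => 1) (fun n => by fun_prop)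
    (fun n => ?_) (by simp) ?_
  · filter_upwards [h] with y hy
    rw [← ENNReal.ofReal_one]
    refine ENNReal.ofReal_le_ofReal (Real.exp_le_one_iff.2 ?_)
    rw [mul_assoc]
    exact mul_nonpos_of_nonneg_of_nonpos (Nat.cast_nonneg n) hy.le
  · filter_upwards [h] with y hy
    rw [← ENNReal.ofReal_zero]
    refine ENNReal.tendsto_ofReal (Real.tendsto_exp_atBot.comp ?_)
    simp_rw [mul_assoc]
    exact tendsto_natCast_atTop_atTop.atTop_mul_const_of_neg hy

/-- Finite endpoints are covered too, since the open interval carries all the mass. -/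
lemma logMGFStar_eq_top_of_notMem {ν : Measure ℝ} [IsProbabilityMeasure ν] {a b : EReal}
    (hν : ∀ᵐ y ∂ν, y ∈ openInterval a b) {x : ℝ} (hx : x ∉ openInterval a b) :
    logMGFStar ν x = ⊤ := by
  by_cases hax : a < (x : EReal)
  · have hb : b ≤ (x : EReal) := not_lt.1 fun hxb => hx ⟨hax, hxb⟩
    refine logMGFStar_eq_top_of_tendsto (tendsto_expMoment_zero (ε := 1) ?_)
    filter_upwards [hν] with y hy
    have : y < x := EReal.coe_lt_coe_iff.1 (hy.2.trans_le hb)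
    linarith
  · refine logMGFStar_eq_top_of_tendsto (tendsto_expMoment_zero (ε := -1) ?_)
    filter_upwards [hν] with y hy
    have : x < y := EReal.coe_lt_coe_iff.1 ((not_lt.1 hax).trans_lt hy.1)
    linarith

/-! ### Sums of independent variables -/

section IID

variable {Ω : Type*} [MeasurableSpace Ω] {P : Measure Ω} [IsProbabilityMeasure P]
  {X : ℕ → Ω → ℝ} {ν : Measure ℝ}

/-- Fubini for the last summand; the inductions behind both the Chernoff bound and the change of
measure run on it. -/
lemma lintegral_comp_sum_range_succ (hX : ∀ i, Measurable (X i)) (hind : iIndepFun X P)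
    (hlaw : ∀ i, P.map (X i) = ν) (n : ℕ) {g : ℝ → ℝ≥0∞} (hg : Measurable g) :
    ∫⁻ w, g (∑ i ∈ Finset.range (n + 1), X i w) ∂P =
      ∫⁻ w, ∫⁻ y, g (∑ i ∈ Finset.range n, X i w + y) ∂ν ∂P := by
  have hS : Measurable fun w => ∑ i ∈ Finset.range n, X i w :=
    Finset.measurable_fun_sum _ fun i _ => hX i
  have hν : IsProbabilityMeasure ν :=
    hlaw 0 ▸ Measure.isProbabilityMeasure_map (hX 0).aemeasurable
  have hpair := (indepFun_iff_map_prod_eq_prod_map_map hS.aemeasurable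
    (hX n).aemeasurable).1 (by
      have := hind.indepFun_sum_range_succ hX n
      simpa [Finset.sum_fn] using this)
  have hg2 : Measurable fun p : ℝ × ℝ => g (p.1 + p.2) := by fun_prop
  calc ∫⁻ w, g (∑ i ∈ Finset.range (n + 1), X i w) ∂P
      = ∫⁻ p : ℝ × ℝ, g (p.1 + p.2)
          ∂(P.map fun w => (∑ i ∈ Finset.range n, X i w, X n w)) := by
        rw [lintegral_map hg2 (hS.prodMk (hX n))]
        simp_rw [Finset.sum_range_succ]
    _ = ∫⁻ w, ∫⁻ y, g (∑ i ∈ Finset.range n, X i w + y) ∂ν ∂P := by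
        rw [hpair, hlaw, lintegral_prod _ hg2.aemeasurable,
          lintegral_map (by fun_prop) hS]

lemma lintegral_exp_sum (hX : ∀ i, Measurable (X i)) (hind : iIndepFun X P)
    (hlaw : ∀ i, P.map (X i) = ν) (γ x : ℝ) (n : ℕ) :
    ∫⁻ w, ENNReal.ofReal (Real.exp (γ * (∑ i ∈ Finset.range n, X i w - n * x))) ∂P =
      expMoment ν γ x ^ n := by
  induction n with
  | zero => simp
  | succ n ih =>
    rw [lintegral_comp_sum_range_succ hX hind hlaw n
      (g := fun s => ENNReal.ofReal (Real.exp (γ * (s - ((n + 1 : ℕ) : ℝ) * x)))) (by fun_prop),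
      pow_succ, ← ih, ← lintegral_mul_const _ (by fun_prop)]
    refine lintegral_congr fun w => ?_
    rw [expMoment, ← lintegral_const_mul _ (by fun_prop)]
    refine lintegral_congr fun y => ?_
    rw [← ENNReal.ofReal_mul (Real.exp_pos _).le, ← Real.exp_add]
    congr 2
    push_cast
    ring

/-- The Chernoff bound, for the upper and for the lower tail according to the sign of `γ`. -/
lemma measure_sampleMean_le_expMoment_pow (hX : ∀ i, Measurable (X i)) (hind : iIndepFun X P)
    (hlaw : ∀ i, P.map (X i) = ν) (γ x : ℝ) {n : ℕ} (hn : n ≠ 0) :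
    P {w | 0 ≤ γ * (sampleMean X n w - x)} ≤ expMoment ν γ x ^ n := by
  rw [← lintegral_exp_sum hX hind hlaw γ x n]
  have hmeas : Measurable fun w =>
      ENNReal.ofReal (Real.exp (γ * (∑ i ∈ Finset.range n, X i w - n * x))) := by fun_prop
  refine le_trans (measure_mono fun w hw => ?_)
    (by simpa using mul_meas_ge_le_lintegral hmeas (μ := P) 1)
  have hn' : (0 : ℝ) < n := by positivity
  have hS : ∑ i ∈ Finset.range n, X i w = n * sampleMean X n w := by
    rw [sampleMean]; field_simp
  simp only [Set.mem_ofPred_eq] at hw ⊢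
  rw [hS]
  have := mul_nonneg hn'.le hw
  linarith

/-- The sign of ε selects the tail. For γ of that sign Chernoff's bound applies; for the other sign
the exponential moment is at least 1 because x lies beyond the mean, and the bound is trivial. Hence
the supremum may run over all γ. -/
lemma expGrowthSup_tail_le (hX : ∀ i, Measurable (X i)) (hind : iIndepFun X P)
    (hlaw : ∀ i, P.map (X i) = ν) (hν : Integrable (fun y : ℝ => y) ν) {ε x : ℝ} (hε : ε ≠ 0)
    (hx : 0 ≤ ε * (x - ∫ y, y ∂ν)) :
    ExpGrowth.expGrowthSup (fun n => P {w | 0 ≤ ε * (sampleMean X n w - x)}) ≤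
      -logMGFStar ν x := by
  have hprob : IsProbabilityMeasure ν :=
    hlaw 0 ▸ Measure.isProbabilityMeasure_map (hX 0).aemeasurable
  refine le_neg_logMGFStar fun γ => ?_
  rw [← ExpGrowth.expGrowthSup_pow]
  refine ExpGrowth.expGrowthSup_eventually_monotone ?_
  filter_upwards [eventually_ne_atTop 0] with n hn
  -- Multiplying by ε² converts the known signs of γε and ε(·) into the sign of γ(·).
  have hε2 : 0 < ε * ε := mul_self_pos.2 hε
  rcases le_total 0 (γ * ε) with hγ | hγ
  · refine le_trans (measure_mono fun w hw => ?_)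
      (measure_sampleMean_le_expMoment_pow hX hind hlaw γ x hn)
    have hw' : 0 ≤ ε * (sampleMean X n w - x) := hw
    refine nonneg_of_mul_nonneg_left (a := γ * (sampleMean X n w - x)) (b := ε * ε) ?_ hε2
    linarith [mul_nonneg hγ hw']
  · refine prob_le_one.trans (one_le_pow₀ (one_le_expMoment ν hν ?_))
    refine nonneg_of_mul_nonneg_left (a := γ * ((∫ y, y ∂ν) - x)) (b := ε * ε) ?_ hε2
    linarith [mul_nonneg (neg_nonneg.2 hγ) hx]

/-- Each part of C on one side of the mean lies in the half-line starting at its point nearest to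
the mean, which belongs to C by closedness. If C contains the mean, the infimum is 0. -/
lemma expGrowthSup_sampleMean_le (hX : ∀ i, Measurable (X i)) (hind : iIndepFun X P)
    (hlaw : ∀ i, P.map (X i) = ν) (hν : Integrable (fun y : ℝ => y) ν) {C : Set ℝ}
    (hC : IsClosed C) :
    ExpGrowth.expGrowthSup (fun n => P {w | sampleMean X n w ∈ C}) ≤
      -(⨅ x ∈ C, logMGFStar ν x) := by
  have hprob : IsProbabilityMeasure ν :=
    hlaw 0 ▸ Measure.isProbabilityMeasure_map (hX 0).aemeasurable
  set m := ∫ y, y ∂ν with hm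
  by_cases hmC : m ∈ C
  · calc ExpGrowth.expGrowthSup (fun n => P {w | sampleMean X n w ∈ C})
        ≤ ExpGrowth.expGrowthSup (fun _ => 1) :=
          ExpGrowth.expGrowthSup_monotone fun n => prob_le_one
      _ = -0 := by simpa using ExpGrowth.expGrowthSup_const one_ne_zero ENNReal.one_ne_top
      _ ≤ -(⨅ x ∈ C, logMGFStar ν x) :=
          EReal.neg_le_neg_iff.2 ((iInf₂_le m hmC).trans (logMGFStar_mean_le_zero ν hν))
  have hside : ∀ ε : ℝ, ε ≠ 0 → ∀ D : Set ℝ,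
      (D.Nonempty → ∃ x ∈ C, 0 ≤ ε * (x - m) ∧ ∀ z ∈ D, 0 ≤ ε * (z - x)) →
      ExpGrowth.expGrowthSup (fun n => P {w | sampleMean X n w ∈ D}) ≤
        -(⨅ x ∈ C, logMGFStar ν x) := by
    intro ε hε D hex
    rcases D.eq_empty_or_nonempty with rfl | hne
    · have : (fun n : ℕ => P {w | sampleMean X n w ∈ (∅ : Set ℝ)}) = 0 := by
        ext n; simp
      rw [this, ExpGrowth.expGrowthSup_zero]
      exact bot_le
    · obtain ⟨x, hxC, hxm, hxD⟩ := hex hne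
      calc ExpGrowth.expGrowthSup (fun n => P {w | sampleMean X n w ∈ D})
          ≤ ExpGrowth.expGrowthSup (fun n => P {w | 0 ≤ ε * (sampleMean X n w - x)}) :=
            ExpGrowth.expGrowthSup_monotone fun n => measure_mono fun w hw => hxD _ hw
        _ ≤ -logMGFStar ν x := expGrowthSup_tail_le hX hind hlaw hν hε hxm
        _ ≤ _ := EReal.neg_le_neg_iff.2 (iInf₂_le x hxC)
  have hright := hside 1 one_ne_zero (C ∩ Set.Ici m) fun hne => by
      have hbdd : BddBelow (C ∩ Set.Ici m) := ⟨m, fun x hx => hx.2⟩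
      have hmem := (hC.inter isClosed_Ici).csInf_mem hne hbdd
      refine ⟨_, hmem.1, ?_, fun z hz => ?_⟩
      · have : m ≤ sInf (C ∩ Set.Ici m) := hmem.2
        linarith
      · have := csInf_le hbdd hz
        linarith
  have hleft := hside (-1) (by norm_num) (C ∩ Set.Iic m) fun hne => by
      have hbdd : BddAbove (C ∩ Set.Iic m) := ⟨m, fun x hx => hx.2⟩
      have hmem := (hC.inter isClosed_Iic).csSup_mem hne hbdd
      refine ⟨_, hmem.1, ?_, fun z hz => ?_⟩
      · have : sSup (C ∩ Set.Iic m) ≤ m := hmem.2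
        linarith
      · have := le_csSup hbdd hz
        linarith
  -- The growth rate of a sum is the larger of the two rates.
  refine le_trans (ExpGrowth.expGrowthSup_monotone fun n => ?_)
    (ExpGrowth.expGrowthSup_add.trans_le (sup_le hright hleft))
  refine le_trans (measure_mono fun w hw => ?_) (measure_union_le _ _)
  rcases le_total m (sampleMean X n w) with h | h
  · exact Or.inl ⟨hw, h⟩
  · exact Or.inr ⟨hw, h⟩

end IID

/-! ### The lower bound: exponential change of measure -/

section LowerBound

variable {Ω : Type*} [MeasurableSpace Ω] {P : Measure Ω} [IsProbabilityMeasure P]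
  {X : ℕ → Ω → ℝ} {ν : Measure ℝ}

/-- If `ν` dominates a multiple of the measure `exp (-γ (y - x)) ρ(dy)`, then sums of independent
variables with law `ν` can be compared with sums of independent variables with law `ρ`. -/
lemma pow_mul_lintegral_comp_sum_le {Ω' : Type*} [MeasurableSpace Ω'] {P' : Measure Ω'}
    [IsProbabilityMeasure P'] {Y : ℕ → Ω' → ℝ} {ρ : Measure ℝ} [SFinite ν] [SFinite ρ]
    (hX : ∀ i, Measurable (X i)) (hind : iIndepFun X P) (hlaw : ∀ i, P.map (X i) = ν)
    (hY : ∀ i, Measurable (Y i)) (hYind : iIndepFun Y P') (hYlaw : ∀ i, P'.map (Y i) = ρ)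
    {c : ℝ≥0∞} {γ x : ℝ}
    (hle : ∀ g : ℝ → ℝ≥0∞, Measurable g →
      c * ∫⁻ y, g y * ENNReal.ofReal (Real.exp (-γ * (y - x))) ∂ρ ≤ ∫⁻ y, g y ∂ν)
    (n : ℕ) {g : ℝ → ℝ≥0∞} (hg : Measurable g) :
    c ^ n * ∫⁻ w, g (∑ i ∈ Finset.range n, Y i w) *
        ENNReal.ofReal (Real.exp (-γ * (∑ i ∈ Finset.range n, Y i w - n * x))) ∂P' ≤
      ∫⁻ w, g (∑ i ∈ Finset.range n, X i w) ∂P := by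
  induction n generalizing g with
  | zero => simp
  | succ n ih =>
    rw [lintegral_comp_sum_range_succ hX hind hlaw n hg,
      lintegral_comp_sum_range_succ hY hYind hYlaw n
        (g := fun s => g s *
          ENNReal.ofReal (Real.exp (-γ * (s - ((n + 1 : ℕ) : ℝ) * x)))) (by fun_prop)]
    -- The induction hypothesis is applied to g with the last summand averaged out under ν.
    refine le_trans ?_ (ih (g := fun s => ∫⁻ y, g (s + y) ∂ν) (by fun_prop))
    rw [pow_succ, mul_assoc, ← lintegral_const_mul _ (by fun_prop)]
    refine mul_le_mul' le_rfl (lintegral_mono fun w => ?_)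
    refine le_trans (le_of_eq ?_) (mul_le_mul_left (hle (fun y => g (∑ i ∈ Finset.range n, Y i w + y))
      (by fun_prop)) _)
    rw [mul_assoc, ← lintegral_mul_const _ (by fun_prop)]
    congr 1
    refine lintegral_congr fun y => ?_
    rw [mul_assoc, ← ENNReal.ofReal_mul (Real.exp_pos _).le, ← Real.exp_add]
    congr 3
    push_cast
    ring

/-- The weak law of large numbers for an independent sequence with a given law. -/
lemma exists_iid_tendsto_measure_sampleMean (ρ : Measure ℝ) [IsProbabilityMeasure ρ]
    (hρ : Integrable (fun y : ℝ => y) ρ) :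
    ∃ (P' : Measure (ℕ → ℝ)) (Y : ℕ → (ℕ → ℝ) → ℝ), IsProbabilityMeasure P' ∧
      (∀ i, Measurable (Y i)) ∧ iIndepFun Y P' ∧ (∀ i, P'.map (Y i) = ρ) ∧
      ∀ δ : ℝ, 0 < δ →
        ∀ᶠ n in atTop, (2⁻¹ : ℝ≥0∞) ≤ P' {w | |sampleMean Y n w - ∫ y, y ∂ρ| < δ} := by
  set P' : Measure (ℕ → ℝ) := Measure.infinitePi fun _ => ρ with hP'
  set Y : ℕ → (ℕ → ℝ) → ℝ := fun i w => w i with hYdef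
  have hY : ∀ i, Measurable (Y i) := fun i => measurable_pi_apply i
  have hYind : iIndepFun Y P' := iIndepFun_infinitePi (X := fun _ y => y) fun _ => measurable_id
  have hYlaw : ∀ i, P'.map (Y i) = ρ := fun i => Measure.infinitePi_map_eval (fun _ => ρ) i
  refine ⟨P', Y, inferInstance, hY, hYind, hYlaw, fun δ hδ => ?_⟩
  have hint : Integrable (Y 0) P' := by
    have h : Integrable (fun y : ℝ => y) (P'.map (Y 0)) := by rwa [hYlaw]
    exact (integrable_map_measure (by fun_prop) (hY 0).aemeasurable).1 h
  have hmean : ∫ w, Y 0 w ∂P' = ∫ y, y ∂ρ := by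
    rw [← hYlaw 0, integral_map (hY 0).aemeasurable (by fun_prop)]
  have hslln := strong_law_ae_real Y hint (fun i j hij => hYind.indepFun hij)
    fun i => ⟨(hY i).aemeasurable, (hY 0).aemeasurable, by rw [hYlaw, hYlaw]⟩
  rw [hmean] at hslln
  have hSm : ∀ n, Measurable (sampleMean Y n) := fun n =>
    (Finset.measurable_fun_sum _ fun i _ => hY i).div_const _
  have hprob := tendstoInMeasure_iff_norm.1 (tendstoInMeasure_of_tendsto_ae
    (f := fun n => sampleMean Y n) (fun n => (hSm n).aestronglyMeasurable) hslln) δ hδ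
  -- Any fixed positive bound below 1 would serve: constants vanish on the exponential scale.
  filter_upwards [hprob.eventually (Iic_mem_nhds (show (0 : ℝ≥0∞) < 2⁻¹ by simp))] with n hn
  have hA : MeasurableSet {w | δ ≤ ‖sampleMean Y n w - ∫ y, y ∂ρ‖} :=
    measurableSet_le measurable_const ((hSm n).sub_const _).norm
  have hcompl : {w | |sampleMean Y n w - ∫ y, y ∂ρ| < δ} =
      {w | δ ≤ ‖sampleMean Y n w - ∫ y, y ∂ρ‖}ᶜ := by
    ext w; simp [Real.norm_eq_abs]
  rw [hcompl, prob_compl_eq_one_sub hA]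
  refine ENNReal.le_sub_of_add_le_right (measure_ne_top _ _) ?_
  calc (2⁻¹ : ℝ≥0∞) + P' {w | δ ≤ ‖sampleMean Y n w - ∫ y, y ∂ρ‖}
      ≤ 2⁻¹ + 2⁻¹ := by gcongr
    _ = 1 := ENNReal.inv_two_add_inv_two

/-- If `exp (γ (y - x)) κ(dy)` has barycenter `x` for a measure `κ ≤ ν`, then sample means of law
`ν` are near `x` with at least the exponential rate given by the total mass of that measure. -/
lemma log_expMoment_le_expGrowthInf (hX : ∀ i, Measurable (X i)) (hind : iIndepFun X P)
    (hlaw : ∀ i, P.map (X i) = ν) {κ : Measure ℝ} [NeZero κ] (hκν : κ ≤ ν) {γ x : ℝ}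
    (hexp : Integrable (fun y => Real.exp (γ * (y - x))) κ)
    (hmul : Integrable (fun y => (y - x) * Real.exp (γ * (y - x))) κ)
    (hzero : ∫ y, (y - x) * Real.exp (γ * (y - x)) ∂κ = 0) {δ : ℝ} (hδ : 0 < δ) :
    ENNReal.log (expMoment κ γ x) ≤
      ExpGrowth.expGrowthInf fun n => P {w | |sampleMean X n w - x| < δ} := by
  have hνprob : IsProbabilityMeasure ν :=
    hlaw 0 ▸ Measure.isProbabilityMeasure_map (hX 0).aemeasurable
  set Z := ∫ y, Real.exp (γ * (y - x)) ∂κ with hZ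
  have hZpos : 0 < Z := integral_exp_pos hexp
  have hmom : expMoment κ γ x = ENNReal.ofReal Z :=
    (ofReal_integral_eq_lintegral_ofReal hexp (ae_of_all _ fun y => (Real.exp_pos _).le)).symm
  -- Once normalised by Z, the tilted law has mean x by `hzero`, so the rare event is typical under
  -- it.
  set ρ := κ.tilted fun y => γ * (y - x) with hρdef
  have hρprob : IsProbabilityMeasure ρ := isProbabilityMeasure_tilted hexp
  have hcent : Integrable (fun y => y - x) ρ := by
    rw [hρdef, integrable_tilted_iff hexp]
    simpa [mul_comm] using hmul
  have hid : Integrable (fun y : ℝ => y) ρ :=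
    (hcent.add (integrable_const x)).congr (ae_of_all _ fun y => by simp)
  have hmean : ∫ y, y ∂ρ = x := by
    have h0 : ∫ y, (y - x) ∂ρ = 0 := by
      rw [hρdef, integral_tilted]
      have : ∀ y : ℝ, (Real.exp (γ * (y - x)) / Z) • (y - x) =
          Z⁻¹ * ((y - x) * Real.exp (γ * (y - x))) := fun y => by
        rw [smul_eq_mul]; ring
      simp_rw [← hZ, this]
      rw [integral_const_mul, hzero, mul_zero]
    rw [integral_sub hid (integrable_const x)] at h0
    simp at h0
    linarith
  obtain ⟨P', Y, hP', hY, hYind, hYlaw, hwlln⟩ := exists_iid_tendsto_measure_sampleMean ρ hid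
  rw [hmean] at hwlln
  -- The tilt is undone exactly: Z exp(-γ(y - x)) ρ(dy) = κ(dy), and κ ≤ ν.
  have hle : ∀ g : ℝ → ℝ≥0∞, Measurable g →
      ENNReal.ofReal Z * ∫⁻ y, g y * ENNReal.ofReal (Real.exp (-γ * (y - x))) ∂ρ ≤
        ∫⁻ y, g y ∂ν := by
    intro g hg
    refine le_trans (le_of_eq ?_) (lintegral_mono' hκν le_rfl)
    rw [hρdef, lintegral_tilted, ← lintegral_const_mul _ (by fun_prop)]
    refine lintegral_congr fun y => ?_
    rw [mul_left_comm (ENNReal.ofReal _) (g y), mul_left_comm (ENNReal.ofReal Z),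
      ← ENNReal.ofReal_mul (by positivity), ← ENNReal.ofReal_mul (by positivity),
      div_mul_eq_mul_div, ← Real.exp_add, mul_div_cancel₀ _ hZpos.ne']
    simp
  -- When the sample mean is within η of x, undoing the tilt loses at most a factor exp(-|γ|η) per
  -- summand. Then η tends to 0 with δ fixed.
  have hsmall : ∀ η : ℝ, 0 < η → η ≤ δ →
      ENNReal.log (ENNReal.ofReal (Z * Real.exp (-|γ| * η))) ≤
        ExpGrowth.expGrowthInf fun n => P {w | |sampleMean X n w - x| < δ} := by
    intro η hη hηδ
    rw [← ExpGrowth.expGrowthInf_pow]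
    refine ExpGrowth.expGrowthInf_of_eventually_ge (b := 2⁻¹) (by simp) ?_
    filter_upwards [hwlln η hη, eventually_ne_atTop 0] with n hn hn0
    have hn' : (0 : ℝ) < n := by positivity
    set B : Set ℝ := {s | |s / n - x| < η} with hB
    have hBm : MeasurableSet B := measurableSet_lt (by fun_prop) measurable_const
    have hcmp := pow_mul_lintegral_comp_sum_le hX hind hlaw hY hYind hYlaw hle n
      (g := B.indicator 1) (measurable_one.indicator hBm)
    have hYm : MeasurableSet {w | |sampleMean Y n w - x| < η} := by
      have : Measurable (sampleMean Y n) :=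
        (Finset.measurable_fun_sum _ fun i _ => hY i).div_const _
      exact measurableSet_lt (by fun_prop) measurable_const
    have hXm : MeasurableSet {w | |sampleMean X n w - x| < η} := by
      have : Measurable (sampleMean X n) :=
        (Finset.measurable_fun_sum _ fun i _ => hX i).div_const _
      exact measurableSet_lt (by fun_prop) measurable_const
    calc 2⁻¹ * ENNReal.ofReal (Z * Real.exp (-|γ| * η)) ^ n
        = ENNReal.ofReal Z ^ n * (ENNReal.ofReal (Real.exp (-|γ| * η)) ^ n * 2⁻¹) := by
          rw [ENNReal.ofReal_mul hZpos.le, mul_pow]; ring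
      _ ≤ ENNReal.ofReal Z ^ n * (ENNReal.ofReal (Real.exp (-|γ| * η)) ^ n *
            P' {w | |sampleMean Y n w - x| < η}) := by gcongr
      _ ≤ _ := by
          gcongr
          rw [← lintegral_indicator_one hYm, ← lintegral_const_mul _
            (measurable_one.indicator hYm)]
          refine lintegral_mono fun w => ?_
          by_cases hw : w ∈ {w | |sampleMean Y n w - x| < η}
          · have hw' : |sampleMean Y n w - x| < η := hw
            have hwB : ∑ i ∈ Finset.range n, Y i w ∈ B := hw
            rw [Set.indicator_of_mem hw, Set.indicator_of_mem hwB]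
            simp only [Pi.one_apply, mul_one, one_mul]
            rw [← ENNReal.ofReal_pow (Real.exp_pos _).le, ← Real.exp_nat_mul]
            refine ENNReal.ofReal_le_ofReal (Real.exp_le_exp.2 ?_)
            have hS : ∑ i ∈ Finset.range n, Y i w = n * sampleMean Y n w := by
              rw [sampleMean]; field_simp
            have hbd : γ * (sampleMean Y n w - x) ≤ |γ| * η :=
              (le_abs_self _).trans (by rw [abs_mul]; gcongr)
            rw [hS]
            nlinarith [mul_le_mul_of_nonneg_left hbd hn'.le]
          · simp [Set.indicator_of_notMem hw]
      _ ≤ _ := hcmp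
      _ = P {w | |sampleMean X n w - x| < η} := by
          rw [← lintegral_indicator_one hXm]
          rfl
      _ ≤ P {w | |sampleMean X n w - x| < δ} :=
          measure_mono fun w (hw : _ < η) => hw.trans_le hηδ
  have hlim : Tendsto (fun η : ℝ => ENNReal.log (ENNReal.ofReal (Z * Real.exp (-|γ| * η))))
      (𝓝[>] 0) (𝓝 (ENNReal.log (ENNReal.ofReal Z))) := by
    have hc : Continuous fun η : ℝ =>
        ENNReal.log (ENNReal.ofReal (Z * Real.exp (-|γ| * η))) :=
      ENNReal.continuous_log.comp (ENNReal.continuous_ofReal.comp (by fun_prop))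
    simpa using (hc.tendsto 0).mono_left nhdsWithin_le_nhds
  rw [hmom]
  refine le_of_tendsto hlim ?_
  filter_upwards [Ioc_mem_nhdsGT hδ] with η hη using hsmall η hη.1 hη.2

end LowerBound

/-! ### The lower bound: truncation -/

section Truncation

/-- Chernoff's inequality read backwards: mass at least c beyond distance ε on both sides of x
forces growth of order c exp(ε|t|). -/
lemma tendsto_mgf_cocompact_atTop {κ : Measure ℝ} [IsFiniteMeasure κ] {x ε : ℝ} (hε : 0 < ε)
    (hexp : ∀ t, Integrable (fun y => Real.exp (t * (y - x))) κ)
    (hpos : κ {y | ε ≤ y - x} ≠ 0) (hneg : κ {y | y - x ≤ -ε} ≠ 0) :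
    Tendsto (mgf (fun y => y - x) κ) (cocompact ℝ) atTop := by
  set c := min (κ.real {y | ε ≤ y - x}) (κ.real {y | y - x ≤ -ε}) with hc
  have hcpos : 0 < c := lt_min (ENNReal.toReal_pos hpos (measure_ne_top _ _))
    (ENNReal.toReal_pos hneg (measure_ne_top _ _))
  have hlim : Tendsto (fun t : ℝ => c * Real.exp (ε * ‖t‖)) (cocompact ℝ) atTop :=
    (Real.tendsto_exp_atTop.comp
      ((tendsto_norm_cocompact_atTop (E := ℝ)).const_mul_atTop hε)).const_mul_atTop hcpos
  refine tendsto_atTop_mono (fun t => ?_) hlim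
  have key : ∀ {p : ℝ}, c ≤ p → p ≤ Real.exp (-(ε * ‖t‖)) * mgf (fun y => y - x) κ t →
      c * Real.exp (ε * ‖t‖) ≤ mgf (fun y => y - x) κ t := by
    intro p hcp hp
    rw [Real.exp_neg, inv_mul_eq_div, le_div_iff₀ (Real.exp_pos _)] at hp
    exact (mul_le_mul_of_nonneg_right hcp (Real.exp_pos _).le).trans hp
  rcases le_total 0 t with ht | ht
  · refine key (min_le_left _ _) ?_
    have := measure_ge_le_exp_mul_mgf ε ht (hexp t)
    rwa [Real.norm_of_nonneg ht, show -(ε * t) = -t * ε by ring]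
  · refine key (min_le_right _ _) ?_
    have := measure_le_le_exp_mul_mgf (-ε) ht (hexp t)
    rwa [Real.norm_of_nonpos ht, show -(ε * -t) = -t * -ε by ring]

variable {Ω : Type*} [MeasurableSpace Ω] {P : Measure Ω} [IsProbabilityMeasure P]
  {X : ℕ → Ω → ℝ} {ν : Measure ℝ}

lemma integrable_exp_mul_restrict_Icc (ν : Measure ℝ) [IsFiniteMeasure ν] (a b t x : ℝ) :
    Integrable (fun y => Real.exp (t * (y - x))) (ν.restrict (Set.Icc a b)) :=
  (Continuous.continuousOn (by fun_prop)).integrableOn_compact isCompact_Icc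

lemma expMoment_eq_ofReal_mgf {κ : Measure ℝ} {γ x : ℝ}
    (hexp : Integrable (fun y => Real.exp (γ * (y - x))) κ) :
    expMoment κ γ x = ENNReal.ofReal (mgf (fun y => y - x) κ γ) :=
  (ofReal_integral_eq_lintegral_ofReal hexp (ae_of_all _ fun _ => (Real.exp_pos _).le)).symm

/-- Truncation makes every exponential moment finite, and coercivity gives the moment generating
function a minimiser γ. Its vanishing derivative there is the barycenter condition. -/
lemma exists_log_expMoment_restrict_le (hX : ∀ i, Measurable (X i)) (hind : iIndepFun X P)
    (hlaw : ∀ i, P.map (X i) = ν) [IsProbabilityMeasure ν] {x ε δ R : ℝ} (hε : 0 < ε) (hδ : 0 < δ)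
    (hpos : ν.restrict (Set.Icc (-R) R) {y | ε ≤ y - x} ≠ 0)
    (hneg : ν.restrict (Set.Icc (-R) R) {y | y - x ≤ -ε} ≠ 0) :
    ∃ γ : ℝ, ENNReal.log (expMoment (ν.restrict (Set.Icc (-R) R)) γ x) ≤
      ExpGrowth.expGrowthInf fun n => P {w | |sampleMean X n w - x| < δ} := by
  set κ := ν.restrict (Set.Icc (-R) R) with hκ
  have hexp : ∀ t, Integrable (fun y => Real.exp (t * (y - x))) κ :=
    fun t => integrable_exp_mul_restrict_Icc ν _ _ t x
  have hne : NeZero κ := ⟨fun h => hpos (by simp [h])⟩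
  obtain ⟨γ, hγ⟩ := (continuous_mgf hexp).exists_forall_le
    (tendsto_mgf_cocompact_atTop hε hexp hpos hneg)
  have hint : γ ∈ interior (integrableExpSet (fun y => y - x) κ) := by
    have : integrableExpSet (fun y => y - x) κ = Set.univ := Set.eq_univ_of_forall hexp
    simp [this]
  have hderiv : ∫ y, (y - x) * Real.exp (γ * (y - x)) ∂κ = 0 := by
    rw [← deriv_mgf hint]
    exact IsLocalMin.deriv_eq_zero (Eventually.of_forall hγ)
  refine ⟨γ, log_expMoment_le_expGrowthInf hX hind hlaw Measure.restrict_le_self (hexp γ) ?_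
    hderiv hδ⟩
  simpa using integrable_pow_mul_exp_of_mem_interior_integrableExpSet hint 1

lemma iSup_expMoment_restrict_Icc (ν : Measure ℝ) (γ x : ℝ) (N : ℕ) :
    ⨆ k : ℕ, expMoment (ν.restrict (Set.Icc (-((N + k : ℕ) : ℝ)) ((N + k : ℕ) : ℝ))) γ x =
      expMoment ν γ x := by
  have hmono : Monotone fun k : ℕ => Set.Icc (-((N + k : ℕ) : ℝ)) ((N + k : ℕ) : ℝ) :=
    fun k l hkl => by
      have : ((N + k : ℕ) : ℝ) ≤ ((N + l : ℕ) : ℝ) := by exact_mod_cast Nat.add_le_add_left hkl N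
      exact Set.Icc_subset_Icc (neg_le_neg this) this
  have hunion : ⋃ k : ℕ, Set.Icc (-((N + k : ℕ) : ℝ)) ((N + k : ℕ) : ℝ) = Set.univ := by
    refine Set.eq_univ_of_forall fun y => Set.mem_iUnion.2 ?_
    obtain ⟨k, hk⟩ := exists_nat_ge |y|
    refine ⟨k, abs_le.1 (hk.trans ?_)⟩
    exact_mod_cast Nat.le_add_left k N
  simp only [expMoment]
  rw [← setLIntegral_iUnion_of_directed _ hmono.directed_le, hunion, Measure.restrict_univ]

/-- Each truncation supplies its own γ. The sets `K k` of admissible γ are nonempty, closed and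
nested, and `K 0` is compact, so some γ serves all truncations; monotone convergence carries its
bound to ν. -/
lemma neg_logMGFStar_le_expGrowthInf (hX : ∀ i, Measurable (X i)) (hind : iIndepFun X P)
    (hlaw : ∀ i, P.map (X i) = ν) {x ε δ : ℝ} (hε : 0 < ε) (hδ : 0 < δ) (N : ℕ)
    (hpos : ν.restrict (Set.Icc (-(N : ℝ)) N) {y | ε ≤ y - x} ≠ 0)
    (hneg : ν.restrict (Set.Icc (-(N : ℝ)) N) {y | y - x ≤ -ε} ≠ 0) :
    -logMGFStar ν x ≤ ExpGrowth.expGrowthInf fun n => P {w | |sampleMean X n w - x| < δ} := by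
  have hνprob : IsProbabilityMeasure ν :=
    hlaw 0 ▸ Measure.isProbabilityMeasure_map (hX 0).aemeasurable
  set a := ExpGrowth.expGrowthInf fun n => P {w | |sampleMean X n w - x| < δ} with ha
  -- This bounds `K 0`: its members have exponential moment at most 1, which coercivity excludes for
  -- large |γ|.
  have ha0 : a ≤ 0 := by
    calc a ≤ ExpGrowth.expGrowthInf fun _ => 1 :=
          ExpGrowth.expGrowthInf_monotone fun n => prob_le_one
      _ = 0 := ExpGrowth.expGrowthInf_const one_ne_zero ENNReal.one_ne_top
  let κ : ℕ → Measure ℝ := fun k =>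
    ν.restrict (Set.Icc (-((N + k : ℕ) : ℝ)) ((N + k : ℕ) : ℝ))
  have hexp : ∀ k t, Integrable (fun y => Real.exp (t * (y - x))) (κ k) :=
    fun k t => integrable_exp_mul_restrict_Icc ν _ _ t x
  have hκmono : Monotone κ := fun k l hkl => by
    have : ((N + k : ℕ) : ℝ) ≤ ((N + l : ℕ) : ℝ) := by exact_mod_cast Nat.add_le_add_left hkl N
    exact Measure.restrict_mono_set _ (Set.Icc_subset_Icc (neg_le_neg this) this)
  have hκ0 : κ 0 = ν.restrict (Set.Icc (-(N : ℝ)) N) := by simp [κ]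
  have hpos' : ∀ k, κ k {y | ε ≤ y - x} ≠ 0 := fun k h =>
    hpos (hκ0 ▸ le_antisymm (h ▸ hκmono (Nat.zero_le k) _) bot_le)
  have hneg' : ∀ k, κ k {y | y - x ≤ -ε} ≠ 0 := fun k h =>
    hneg (hκ0 ▸ le_antisymm (h ▸ hκmono (Nat.zero_le k) _) bot_le)
  let K : ℕ → Set ℝ := fun k => {γ | ENNReal.log (expMoment (κ k) γ x) ≤ a}
  have hclosed : ∀ k, IsClosed (K k) := fun k => by
    have hc : Continuous fun γ => ENNReal.log (expMoment (κ k) γ x) := by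
      simp_rw [expMoment_eq_ofReal_mgf (hexp k _)]
      exact ENNReal.continuous_log.comp (ENNReal.continuous_ofReal.comp (continuous_mgf (hexp k)))
    exact isClosed_le hc continuous_const
  have hcompact : IsCompact (K 0) := by
    have hev := (tendsto_mgf_cocompact_atTop hε (hexp 0) (hpos' 0) (hneg' 0)).eventually_gt_atTop 1
    obtain ⟨T, hT, hTK⟩ := mem_cocompact.1 hev
    refine hT.of_isClosed_subset (hclosed 0) fun γ hγ => ?_
    by_contra hγT
    have h1 : 1 < mgf (fun y => y - x) (κ 0) γ := hTK hγT
    have h2 : ENNReal.log (expMoment (κ 0) γ x) ≤ 0 := le_trans hγ ha0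
    rw [ENNReal.log_le_zero_iff, expMoment_eq_ofReal_mgf (hexp 0 γ),
      ENNReal.ofReal_le_one] at h2
    linarith
  have hanti : ∀ k, K (k + 1) ⊆ K k := fun k γ hγ =>
    le_trans (ENNReal.log_le_log (lintegral_mono' (hκmono (Nat.le_succ k)) le_rfl)) hγ
  have hnonempty : ∀ k, (K k).Nonempty := fun k =>
    exists_log_expMoment_restrict_le hX hind hlaw hε hδ (hpos' k) (hneg' k)
  obtain ⟨γ, hγ⟩ := IsCompact.nonempty_iInter_of_sequence_nonempty_isCompact_isClosed K hanti
    hnonempty hcompact hclosed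
  have hle : expMoment ν γ x ≤ EReal.exp a := by
    rw [← iSup_expMoment_restrict_Icc ν γ x N]
    refine iSup_le fun k => ?_
    rw [← ENNReal.log_le_log_iff, EReal.log_exp]
    exact Set.mem_iInter.1 hγ k
  rw [← ENNReal.log_le_log_iff, EReal.log_exp] at hle
  exact (EReal.neg_le.1 (neg_log_expMoment_le ν γ x)).trans hle

end Truncation

/-! ### Laws with strictly increasing distribution function on an interval -/

lemma isOpen_openInterval (a b : EReal) : IsOpen (openInterval a b) :=
  (isOpen_lt continuous_const continuous_coe_real_ereal).inter
    (isOpen_lt continuous_coe_real_ereal continuous_const)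

lemma convex_openInterval (a b : EReal) : Convex ℝ (openInterval a b) :=
  Set.OrdConnected.convex ⟨fun _ hx _ hy _ hz =>
    ⟨hx.1.trans_le (EReal.coe_le_coe_iff.2 hz.1), (EReal.coe_le_coe_iff.2 hz.2).trans_lt hy.2⟩⟩

lemma exists_restrict_Icc_ne_zero {ν : Measure ℝ} [IsProbabilityMeasure ν] {a b : EReal}
    (hmono : StrictMonoOn (cdf ν) (openInterval a b)) {x : ℝ} (hx : x ∈ openInterval a b) :
    ∃ ε : ℝ, 0 < ε ∧ ∃ N : ℕ,
      ν.restrict (Set.Icc (-(N : ℝ)) N) {y | ε ≤ y - x} ≠ 0 ∧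
      ν.restrict (Set.Icc (-(N : ℝ)) N) {y | y - x ≤ -ε} ≠ 0 := by
  obtain ⟨r, hr, hball⟩ := Metric.isOpen_iff.1 (isOpen_openInterval a b) x hx
  have hmem : ∀ s, |s| < r → x + s ∈ openInterval a b := fun s hs =>
    hball (by simpa [Real.dist_eq] using hs)
  have hIoc : ∀ s t, |s| < r → |t| < r → s < t → ν (Set.Ioc (x + s) (x + t)) ≠ 0 := by
    intro s t hs ht hst
    have h := hmono (hmem s hs) (hmem t ht) (by linarith)
    rw [← measure_cdf ν, StieltjesFunction.measure_Ioc]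
    simpa using h
  obtain ⟨N, hN⟩ := exists_nat_ge (|x| + r)
  have hxN := abs_le.1 (show |x| ≤ N - r by linarith)
  have hpos : ∀ (s t : ℝ) (A : Set ℝ), |s| < r → |t| < r → s < t →
      Set.Ioc (x + s) (x + t) ⊆ A → ν.restrict (Set.Icc (-(N : ℝ)) N) A ≠ 0 := by
    intro s t A hs ht hst hA h0
    refine hIoc s t hs ht hst ?_
    have hs' := abs_lt.1 hs
    have ht' := abs_lt.1 ht
    have hsub : Set.Ioc (x + s) (x + t) ⊆ Set.Icc (-(N : ℝ)) N := fun y hy =>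
      ⟨by linarith [hy.1], by linarith [hy.2]⟩
    have := measure_mono_null hA h0
    rwa [Measure.restrict_apply measurableSet_Ioc, Set.inter_eq_left.2 hsub] at this
  -- The intervals (x + r/4, x + r/2] and (x - r/2, x - r/4] carry mass, since the distribution
  -- function increases strictly across them.
  refine ⟨r / 4, by positivity, N, ?_, ?_⟩
  · refine hpos (r / 4) (r / 2) _ ?_ ?_ (by linarith) fun y hy => ?_
    · rw [abs_of_pos (by positivity)]; linarith
    · rw [abs_of_pos (by positivity)]; linarith
    · change r / 4 ≤ y - x
      linarith [hy.1]
  · refine hpos (-(r / 2)) (-(r / 4)) _ ?_ ?_ (by linarith) fun y hy => ?_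
    · rw [abs_neg, abs_of_pos (by positivity)]; linarith
    · rw [abs_neg, abs_of_pos (by positivity)]; linarith
    · change y - x ≤ -(r / 4)
      linarith [hy.2]

/-! ### Sample means and the contraction principle -/

section SampleMean

variable {Ω : Type*} [MeasurableSpace Ω] {P : Measure Ω}
  {X : ℕ → Ω → ℝ} {ν : Measure ℝ} {a b : EReal}

lemma measurable_sampleMean (hX : ∀ i, Measurable (X i)) (n : ℕ) : Measurable (sampleMean X n) :=
  (Finset.measurable_fun_sum _ fun i _ => hX i).div_const _

/-- Intervals are convex. The empty mean is 0, which may fall outside, hence n ≠ 0. -/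
lemma ae_sampleMean_mem (hX : ∀ i, Measurable (X i)) (hlaw : ∀ i, P.map (X i) = ν)
    (hν : ∀ᵐ y ∂ν, y ∈ openInterval a b) {n : ℕ} (hn : n ≠ 0) :
    ∀ᵐ w ∂P, sampleMean X n w ∈ openInterval a b := by
  have hall : ∀ᵐ w ∂P, ∀ i, X i w ∈ openInterval a b :=
    ae_all_iff.2 fun i => ae_of_ae_map (hX i).aemeasurable (by rwa [hlaw])
  filter_upwards [hall] with w hw
  have h := (convex_openInterval a b).sum_mem (t := Finset.range n) (w := fun _ => (n : ℝ)⁻¹)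
    (z := fun i => X i w) (fun _ _ => by positivity)
    (by simp [hn]) fun i _ => hw i
  rwa [← Finset.smul_sum, smul_eq_mul, inv_mul_eq_div] at h

variable [IsProbabilityMeasure P]

lemma neg_logMGFStar_le_expGrowthInf_of_mem (hX : ∀ i, Measurable (X i)) (hind : iIndepFun X P)
    (hlaw : ∀ i, P.map (X i) = ν) (hmono : StrictMonoOn (cdf ν) (openInterval a b))
    {U : Set ℝ} (hU : IsOpen U) {x : ℝ} (hxU : x ∈ U) (hx : x ∈ openInterval a b) :
    -logMGFStar ν x ≤ ExpGrowth.expGrowthInf fun n => P {w | sampleMean X n w ∈ U} := by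
  have hprob : IsProbabilityMeasure ν :=
    hlaw 0 ▸ Measure.isProbabilityMeasure_map (hX 0).aemeasurable
  obtain ⟨ε, hε, N, hpos, hneg⟩ := exists_restrict_Icc_ne_zero hmono hx
  obtain ⟨δ, hδ, hball⟩ := Metric.isOpen_iff.1 hU x hxU
  refine (neg_logMGFStar_le_expGrowthInf hX hind hlaw hε hδ N hpos hneg).trans
    (ExpGrowth.expGrowthInf_monotone fun n => measure_mono fun w hw => hball ?_)
  simpa [Real.dist_eq] using hw

variable {𝒲 : Type*} [TopologicalSpace 𝒲] {g : ℝ → 𝒲} {J : 𝒲 → EReal}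

/-- Contraction of the large deviation principle of the sample means by a map which is continuous
on the interval that carries the law of the sample. -/
lemma satisfiesLDP_comp_sampleMean [MeasurableSpace 𝒲] [BorelSpace 𝒲]
    (hX : ∀ i, Measurable (X i)) (hind : iIndepFun X P)
    (hlaw : ∀ i, P.map (X i) = ν) (hν : ∀ᵐ y ∂ν, y ∈ openInterval a b)
    (hint : Integrable (fun y : ℝ => y) ν) (hmono : StrictMonoOn (cdf ν) (openInterval a b))
    (hg : ContinuousOn g (openInterval a b)) (hJ : IsRateFunction J)
    (hJg : ∀ m ∈ openInterval a b, J (g m) = logMGFStar ν m)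
    (hJtop : ∀ w ∉ g '' openInterval a b, J w = ⊤) :
    SatisfiesLDP P (fun n w => g (sampleMean X n w)) J where
  aemeasurable n hn := by
    have hmem := ae_sampleMean_mem hX hlaw hν (Nat.one_le_iff_ne_zero.1 hn)
    classical
    -- Off the interval g is uncontrolled; a constant replaces it there, which changes g(X̄ₙ) only
    -- on a null event.
    have hgm : Measurable ((openInterval a b).piecewise g fun _ => g 0) :=
      hg.measurable_piecewise continuousOn_const (isOpen_openInterval a b).measurableSet
    refine ⟨_, hgm.comp (measurable_sampleMean hX n), ?_⟩
    filter_upwards [hmem] with w hw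
    simp [Set.piecewise_eq_of_mem _ _ _ hw]
  isRateFunction := hJ
  lower_bound O hO := by
    rw [EReal.neg_le]
    refine le_iInf₂ fun w hw => ?_
    rw [EReal.neg_le]
    by_cases hwI : w ∈ g '' openInterval a b
    · obtain ⟨m, hm, rfl⟩ := hwI
      rw [hJg m hm]
      have hU := hg.isOpen_inter_preimage (isOpen_openInterval a b) hO
      exact (neg_logMGFStar_le_expGrowthInf_of_mem hX hind hlaw hmono hU ⟨hm, hw⟩ hm).trans
        (ExpGrowth.expGrowthInf_monotone fun n => measure_mono fun _ h => h.2)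
    · simp [hJtop w hwI]
  upper_bound C hC := by
    have hprob : IsProbabilityMeasure ν :=
      hlaw 0 ▸ Measure.isProbabilityMeasure_map (hX 0).aemeasurable
    -- D need not be closed in ℝ. A point added by its closure is either in the interval, where
    -- continuity puts its image in C, or outside, where Λ* is infinite.
    set D := openInterval a b ∩ g ⁻¹' C with hD
    have hDclosure : ∀ x ∈ closure D, x ∈ openInterval a b → g x ∈ C := by
      intro x hx hxI
      have hcl := (hg x hxI).mono_left (nhdsWithin_mono x (Set.inter_subset_left (t := g ⁻¹' C)))
      have := mem_closure_iff_nhdsWithin_neBot.1 hx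
      exact hC.mem_of_tendsto hcl
        (eventually_nhdsWithin_of_forall fun y hy => hy.2)
    have hle : (⨅ w ∈ C, J w) ≤ ⨅ x ∈ closure D, logMGFStar ν x := by
      refine le_iInf₂ fun x hx => ?_
      by_cases hxI : x ∈ openInterval a b
      · rw [← hJg x hxI]
        exact iInf₂_le (g x) (hDclosure x hx hxI)
      · rw [logMGFStar_eq_top_of_notMem hν hxI]
        exact le_top
    refine le_trans ?_ ((expGrowthSup_sampleMean_le hX hind hlaw hint
      (isClosed_closure (s := D))).trans (EReal.neg_le_neg_iff.2 hle))
    refine ExpGrowth.expGrowthSup_eventually_monotone ?_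
    filter_upwards [eventually_ne_atTop 0] with n hn
    refine measure_mono_ae ?_
    filter_upwards [ae_sampleMean_mem hX hlaw hν hn] with w hw hwC
    exact subset_closure ⟨hw, hwC⟩

/-- Level sets of I lie in S, where g is continuous, so those of J are their compact images; compact
sets are closed in a Hausdorff space, which gives lower semicontinuity. -/
lemma isGoodRateFunction_of_image [T2Space 𝒲] {I : ℝ → EReal} {S : Set ℝ}
    (hI : IsGoodRateFunction I) (hItop : ∀ x ∉ S, I x = ⊤) (hg : ContinuousOn g S)
    (hJg : ∀ m ∈ S, J (g m) = I m) (hJtop : ∀ w ∉ g '' S, J w = ⊤) :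
    IsGoodRateFunction J := by
  have hnonneg : ∀ w, 0 ≤ J w := fun w => by
    by_cases hw : w ∈ g '' S
    · obtain ⟨m, hm, rfl⟩ := hw
      exact hJg m hm ▸ hI.nonneg m
    · simp [hJtop w hw]
  have hcompact : ∀ η : ℝ, 0 ≤ η → IsCompact {w | J w ≤ (η : EReal)} := fun η hη => by
    have hsub : {x | I x ≤ (η : EReal)} ⊆ S := fun x hx => by
      by_contra hxS
      have hx' : I x ≤ (η : EReal) := hx
      simp [hItop x hxS] at hx'
    have heq : {w | J w ≤ (η : EReal)} = g '' {x | I x ≤ (η : EReal)} := by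
      ext w
      constructor
      · intro (hw : J w ≤ _)
        by_cases hwS : w ∈ g '' S
        · obtain ⟨m, hm, rfl⟩ := hwS
          exact ⟨m, show I m ≤ _ from hJg m hm ▸ hw, rfl⟩
        · simp [hJtop w hwS] at hw
      · rintro ⟨x, hx, rfl⟩
        exact (hJg x (hsub hx)).trans_le hx
    rw [heq]
    exact (hI.isCompact_le η hη).image_of_continuousOn (hg.mono hsub)
  refine ⟨⟨hnonneg, lowerSemicontinuous_iff_isClosed_preimage.2 fun c => ?_⟩, hcompact⟩
  induction c with
  | bot =>
    convert! isClosed_empty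
    ext w
    simpa using ((EReal.bot_lt_zero).trans_le (hnonneg w)).ne'
  | top => simp
  | coe η =>
    rcases le_or_gt 0 η with hη | hη
    · exact (hcompact η hη).isClosed
    · convert! isClosed_empty
      ext w
      simpa using lt_of_lt_of_le (EReal.coe_neg'.2 hη) (hnonneg w)

end SampleMean

/-! ### Moment-matching estimators -/

section Model

variable {Θ : Set ℝ} {F : Θ → Measure ℝ} {α ω : Θ → EReal}

lemma openInterval_subset_meanSpace (θ₀ : Θ) :
    openInterval (α θ₀) (ω θ₀) ⊆ meanSpace α ω :=
  Set.subset_iUnion (fun θ => openInterval (α θ) (ω θ)) θ₀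

lemma mmRateReal_coe (θ₀ θ : Θ) : mmRateReal F α ω θ₀ (θ : ℝ) = mmRate F α ω θ₀ θ := by
  simp [mmRateReal]

lemma MMCondition.ae_mem_openInterval (hF : MMCondition F α ω) (θ : Θ) :
    ∀ᵐ y ∂(F θ), y ∈ openInterval (α θ) (ω θ) := by
  have := hF.isProbabilityMeasure θ
  exact (mem_ae_iff_prob_eq_one (isOpen_openInterval _ _).measurableSet).2 (hF.concentrated θ)

variable [Nonempty Θ]

lemma MMCondition.mean_meanInv (hF : MMCondition F α ω) {m : ℝ} (hm : m ∈ meanSpace α ω) :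
    mean F (meanInv F m) = m :=
  Function.invFun_eq (hF.existsUnique_mean_eq m hm).exists

/-- Uniqueness of the solution of μ(θ) = m enters here. -/
lemma MMCondition.meanInv_mean (hF : MMCondition F α ω) {θ : Θ} (hθ : mean F θ ∈ meanSpace α ω) :
    meanInv F (mean F θ) = θ :=
  (hF.existsUnique_mean_eq _ hθ).unique (hF.mean_meanInv hθ) rfl

lemma MMCondition.mmRate_meanInv (hF : MMCondition F α ω) (θ₀ : Θ) {m : ℝ}
    (hm : m ∈ openInterval (α θ₀) (ω θ₀)) :
    mmRate F α ω θ₀ (meanInv F m) = logMGFStar (F θ₀) m := by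
  have h := hF.mean_meanInv (openInterval_subset_meanSpace θ₀ hm)
  simp [mmRate, h, hm]

lemma MMCondition.mmRate_eq_top (hF : MMCondition F α ω) (θ₀ : Θ) {θ : Θ}
    (hθ : θ ∉ meanInv F '' openInterval (α θ₀) (ω θ₀)) : mmRate F α ω θ₀ θ = ⊤ := by
  refine if_neg fun h => hθ ⟨_, h, hF.meanInv_mean (openInterval_subset_meanSpace θ₀ h)⟩

lemma MMCondition.mmRateReal_eq_top (hF : MMCondition F α ω) (θ₀ : Θ) {t : ℝ}
    (ht : t ∉ (fun m => (meanInv F m : ℝ)) '' openInterval (α θ₀) (ω θ₀)) :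
    mmRateReal F α ω θ₀ t = ⊤ := by
  by_cases h : t ∈ Θ
  · lift t to Θ using h
    rw [mmRateReal_coe]
    refine hF.mmRate_eq_top θ₀ fun ⟨m, hm, hmt⟩ => ht ⟨m, hm, ?_⟩
    simp [hmt]
  · simp [mmRateReal, h]

end Model

end MMEst

end

open MMEst
theorem proposition4p1 {Θ : Set ℝ} [Nonempty Θ] (F : Θ → Measure ℝ) (α ω : Θ → EReal)
    (hF : MMCondition F α ω) (θ₀ : Θ)
    {Ω : Type*} [MeasurableSpace Ω] (P : Measure Ω) [IsProbabilityMeasure P]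
    (X : ℕ → Ω → ℝ) (hX_meas : ∀ i, Measurable (X i)) (hX_indep : iIndepFun X P)
    (hX_law : ∀ i, P.map (X i) = F θ₀) :
    -- (i) affine inverse: LDP on `Θ` and on `ℝ`
    ((∃ c₁ c₀ : ℝ, c₁ ≠ 0 ∧ ∀ m ∈ meanSpace α ω, (meanInv F m : ℝ) = c₁ * m + c₀) →
      SatisfiesLDP P (mmEstimator F X) (mmRate F α ω θ₀) ∧
      SatisfiesLDP P (fun n x => (mmEstimator F X n x : ℝ)) (mmRateReal F α ω θ₀)) ∧
    -- (ii) continuous inverse, good `Λ*`: the same LDP, with a good rate function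
    (ContinuousOn (meanInv F) (openInterval (α θ₀) (ω θ₀)) →
      IsGoodRateFunction (logMGFStar (F θ₀)) →
      (SatisfiesLDP P (mmEstimator F X) (mmRate F α ω θ₀) ∧
        IsGoodRateFunction (mmRate F α ω θ₀)) ∧
      (SatisfiesLDP P (fun n x => (mmEstimator F X n x : ℝ)) (mmRateReal F α ω θ₀) ∧
        IsGoodRateFunction (mmRateReal F α ω θ₀))) := by
  have hprob := hF.isProbabilityMeasure θ₀
  have hae := hF.ae_mem_openInterval θ₀
  have hLDP : ContinuousOn (meanInv F) (openInterval (α θ₀) (ω θ₀)) →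
      IsRateFunction (mmRate F α ω θ₀) → SatisfiesLDP P (mmEstimator F X) (mmRate F α ω θ₀) :=
    fun hg hJ => satisfiesLDP_comp_sampleMean hX_meas hX_indep hX_law hae (hF.integrable θ₀)
      (hF.strictMonoOn_cdf θ₀) hg hJ (fun _ hm => hF.mmRate_meanInv θ₀ hm)
      fun _ hθ => hF.mmRate_eq_top θ₀ hθ
  have hJreal : ∀ m ∈ openInterval (α θ₀) (ω θ₀),
      mmRateReal F α ω θ₀ (meanInv F m) = logMGFStar (F θ₀) m := fun m hm => by
    rw [mmRateReal_coe, hF.mmRate_meanInv θ₀ hm]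
  have hLDPreal : ContinuousOn (fun m => (meanInv F m : ℝ)) (openInterval (α θ₀) (ω θ₀)) →
      IsRateFunction (mmRateReal F α ω θ₀) →
      SatisfiesLDP P (fun n x => (mmEstimator F X n x : ℝ)) (mmRateReal F α ω θ₀) :=
    fun hg hJ => satisfiesLDP_comp_sampleMean hX_meas hX_indep hX_law hae (hF.integrable θ₀)
      (hF.strictMonoOn_cdf θ₀) hg hJ hJreal fun _ ht => hF.mmRateReal_eq_top θ₀ ht
  have hstar : ∀ x ∉ openInterval (α θ₀) (ω θ₀), logMGFStar (F θ₀) x = ⊤ :=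
    fun x hx => logMGFStar_eq_top_of_notMem hae hx
  refine ⟨fun ⟨c₁, c₀, hc₁, hinv⟩ => ?_, fun hg hgood => ?_⟩
  · have hinv' : ∀ m ∈ openInterval (α θ₀) (ω θ₀), (meanInv F m : ℝ) = c₁ * m + c₀ :=
      fun m hm => hinv m (openInterval_subset_meanSpace θ₀ hm)
    have hgreal : ContinuousOn (fun m => (meanInv F m : ℝ)) (openInterval (α θ₀) (ω θ₀)) :=
      ContinuousOn.congr (f := fun m => c₁ * m + c₀) (by fun_prop) hinv'
    have hg : ContinuousOn (meanInv F) (openInterval (α θ₀) (ω θ₀)) :=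
      Topology.IsInducing.subtypeVal.continuousOn_iff.2 hgreal
    -- The formula holds on all of ℝ because both sides are infinite off the image of the interval;
    -- lower semicontinuity of J then follows from that of Λ*.
    have hrate : mmRateReal F α ω θ₀ = fun t => logMGFStar (F θ₀) ((t - c₀) / c₁) := by
      funext t
      by_cases hm : (t - c₀) / c₁ ∈ openInterval (α θ₀) (ω θ₀)
      · rw [← hJreal _ hm, hinv' _ hm]
        congr 1
        field_simp
        ring
      · rw [hstar _ hm]
        refine hF.mmRateReal_eq_top θ₀ ?_
        rintro ⟨m, hmI, rfl⟩
        refine hm ?_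
        simp only [hinv' m hmI]
        rwa [add_sub_cancel_right, mul_div_cancel_left₀ _ hc₁]
    have hΛ := isRateFunction_logMGFStar (F θ₀)
    have hJr : IsRateFunction (mmRateReal F α ω θ₀) := by
      rw [hrate]
      exact ⟨fun t => hΛ.nonneg _, hΛ.lowerSemicontinuous.comp (by fun_prop)⟩
    have hJ : IsRateFunction (mmRate F α ω θ₀) := by
      have : mmRate F α ω θ₀ = fun θ : Θ => mmRateReal F α ω θ₀ θ :=
        funext fun θ => (mmRateReal_coe θ₀ θ).symm
      rw [this]
      exact ⟨fun θ => hJr.nonneg _, hJr.lowerSemicontinuous.comp continuous_subtype_val⟩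
    exact ⟨hLDP hg hJ, hLDPreal hgreal hJr⟩
  · have hgreal : ContinuousOn (fun m => (meanInv F m : ℝ)) (openInterval (α θ₀) (ω θ₀)) :=
      continuous_subtype_val.comp_continuousOn hg
    have hJ := isGoodRateFunction_of_image hgood hstar hg (fun _ hm => hF.mmRate_meanInv θ₀ hm)
      fun _ hθ => hF.mmRate_eq_top θ₀ hθ
    have hJr := isGoodRateFunction_of_image hgood hstar hgreal hJreal
      fun _ ht => hF.mmRateReal_eq_top θ₀ ht
    exact ⟨⟨hLDP hg hJ.toIsRateFunction, hJ⟩, hLDPreal hgreal hJr.toIsRateFunction, hJr⟩
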